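/- Let $\mathbb{K}$ be a field of prime characteristic $p$, let $R=\mathbb{K}[[x,y,z]]$, let $I\subseteq R$ be any ideal, and let $S=R/I$. For an ideal $J$ of $R$ let $J^{[p^e]}$ be the ideal generated by all $a^{p^e}$ with $a\in J$, and for $\beta\ge 1$ put $K_\beta=(I^{[p^\beta]}:I)$. Let $E$ be the $R$-module of inverse polynomials, with $\mathbb{K}$-basis the monomials $x^{-i}y^{-j}z^{-k}$, $i,j,k\ge 1$, on which power series act by multiplication, a monomial with some non-negative exponent being read as $0$. Let $f:E\to E$ be the standard Frobenius map, that is, the additive map with $f(\lambda x^{-i}y^{-j}z^{-k})=\lambda^p x^{-pi}y^{-pj}z^{-pk}$. Let $E_S=\{m\in E: Im=0\}$. For an $S$-module $M$ and $e\ge 0$ let $\mathcal{F}^e(M)$ be the group of additive maps $\phi:M\to M$ with $\phi(sm)=s^{p^e}\phi(m)$ for all $s\in S$, $m\in M$, and let $\mathcal{F}(M)=\bigoplus_{e\ge 0}\mathcal{F}^e(M)$ (external direct sum), a ring under composition. For $e\ge 1$ let $\mathcal{F}_{<e}$ be the $S$-subalgebra of $\mathcal{F}(E_S)$ generated by $\mathcal{F}^0(E_S),\dots,\mathcal{F}^{e-1}(E_S)$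 (equivalently the subring, as it contains the image of $S$), and let $$L_e=\sum_{\substack{1\le\beta_1,\dots,\beta_s<e\\ \beta_1+\dots+\beta_s=e}} K_{\beta_1}K_{\beta_2}^{[p^{\beta_1}]}K_{\beta_3}^{[p^{\beta_1+\beta_2}]}\cdots K_{\beta_s}^{[p^{\beta_1+\dots+\beta_{s-1}}]}$$ (an empty sum is the zero ideal). Then $E$ is an injective hull of the residue field of $R$, and if $I\ne R$ then $S$ is local and $E_S$ is an injective hull over $S$ of the residue field of $S$. Moreover, for every $e\ge 1$, $$\mathcal{F}_{<e}\cap\mathcal{F}^e(E_S)=L_e f^e,$$ where $L_ef^e$ is the set of the maps $m\mapsto a f^e(m)$ on $E_S$ with $a\in L_e$; in particular each of these maps sends $E_S$ into $E_S$. -/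

import Mathlib

open scoped DirectSum

universe u v

namespace FrobeniusMaps

/-! ### The algebra of Frobenius maps of a module -/

section Algebra

/-- The additive group of `p ^ e`-Frobenius maps of an `S`-module `M`: additive maps `φ : M → M`
with `φ (s m) = s ^ (p ^ e) φ m`. -/
def frobMaps (S : Type u) [CommRing S] (p : ℕ) (M : Type v) [AddCommGroup M] [Module S M]
    (e : ℕ) : AddSubgroup (AddMonoid.End M) where
  carrier := {φ | ∀ (s : S) (m : M), φ (s • m) = s ^ (p ^ e) • φ m}
  zero_mem' := by
    intro s m
    simp
  add_mem' := by
    intro a b ha hb s m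
    have h1 : a (s • m) = s ^ (p ^ e) • a m := ha s m
    have h2 : b (s • m) = s ^ (p ^ e) • b m := hb s m
    change a (s • m) + b (s • m) = s ^ (p ^ e) • (a m + b m)
    rw [h1, h2, smul_add]
  neg_mem' := by
    intro a ha s m
    have h1 : a (s • m) = s ^ (p ^ e) • a m := ha s m
    change -a (s • m) = s ^ (p ^ e) • -a m
    rw [h1, smul_neg]

/-- Composition of Frobenius maps is additive in the exponent, so that the external direct sum
`⨁ e, frobMaps S p M e` is a (noncommutative) ring whose multiplication is composition. -/
instance frobMaps_gradedMonoid (S : Type u) [CommRing S] (p : ℕ) (M : Type v) [AddCommGroup M]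
    [Module S M] : SetLike.GradedMonoid (frobMaps S p M) where
  one_mem := by
    intro s m
    simp
  mul_mem := by
    intro i j a b ha hb s m
    change ∀ (s : S) (m : M), a (s • m) = s ^ (p ^ i) • a m at ha
    change ∀ (s : S) (m : M), b (s • m) = s ^ (p ^ j) • b m at hb
    change a (b (s • m)) = s ^ (p ^ (i + j)) • a (b m)
    rw [hb, ha, ← pow_mul, ← pow_add, add_comm j i]

/-- The graded ring of all Frobenius maps of `M`, an external direct sum. -/
abbrev FrobAlg (S : Type u) [CommRing S] (p : ℕ) (M : Type v) [AddCommGroup M] [Module S M] :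
    Type v :=
  ⨁ e, frobMaps S p M e

/-- The subalgebra of `FrobAlg S p M` generated by the homogeneous elements of degree `< e`.
For `1 ≤ e` it contains the whole degree-zero part, hence the scalars from `S`,
so the generated subring is the generated `S`-subalgebra. -/
def frobAlgLT (S : Type u) [CommRing S] (p : ℕ) (M : Type v) [AddCommGroup M] [Module S M]
    (e : ℕ) : Subring (FrobAlg S p M) :=
  Subring.closure
    {x | ∃ (i : ℕ) (φ : frobMaps S p M i), i < e ∧
      x = DirectSum.of (fun j => frobMaps S p M j) i φ}

end Algebra

/-! ### Ideals: Frobenius powers, colons, and the ideals `L e` -/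

section Ideals

/-- The Frobenius power `I^[p^e]`, generated by the `p ^ e`-th powers of the elements of `I`. -/
def frobPower {R : Type u} [CommRing R] (p : ℕ) (I : Ideal R) (e : ℕ) : Ideal R :=
  Ideal.span {x | ∃ a ∈ I, x = a ^ (p ^ e)}

/-- The colon ideal `K_e = (I^[p^e] : I)`. -/
def colonIdeal {R : Type u} [CommRing R] (p : ℕ) (I : Ideal R) (e : ℕ) : Ideal R :=
  (frobPower p I e).colon (I : Set R)

/-- The sum over all compositions `β₁ + ⋯ + βₛ = e` with every `βᵢ < e` of the products
`K_{β₁} K_{β₂}^[p^β₁] ⋯ K_{βₛ}^[p^(β₁ + ⋯ + βₛ₋₁)]`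
(`c.sizeUpTo i` is the sum of the blocks of `c` that precede the block `i`). -/
def lIdeal {R : Type u} [CommRing R] (p : ℕ) (I : Ideal R) (e : ℕ) : Ideal R :=
  ⨆ (c : Composition e) (_ : ∀ i : Fin c.length, c.blocksFun i < e),
    ∏ i : Fin c.length, frobPower p (colonIdeal p I (c.blocksFun i)) (c.sizeUpTo i)

end Ideals

/-! ### Injective hulls -/

/-- `M` is an injective hull of `N`: it is injective and an essential extension of `N`. -/
def IsInjectiveHull (A : Type u) [CommRing A] (N M : Type v) [AddCommGroup N] [Module A N]
    [AddCommGroup M] [Module A M] : Prop :=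
  Module.Injective A M ∧
    ∃ j : N →ₗ[A] M, Function.Injective j ∧
      ∀ U : Submodule A M, U ≠ ⊥ → U ⊓ LinearMap.range j ≠ ⊥

/-! ### Power series in three variables and inverse polynomials -/

section InversePolynomials

/-- The power series ring `K⟦x, y, z⟧`. -/
abbrev PS (K : Type u) [Field K] : Type u := MvPowerSeries (Fin 3) K

/-- The module of inverse polynomials, with `K`-basis the monomials `x^(-a) y^(-b) z^(-c)`,
`a, b, c ≥ 1`. Exponents are shifted by one:
`Finsupp.single n c` stands for `c * x^(-(n 0 + 1)) y^(-(n 1 + 1)) z^(-(n 2 + 1))`. -/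
abbrev InvPoly (K : Type u) [Field K] : Type u := (Fin 3 →₀ ℕ) →₀ K

/-- Multiplication by the power series `a` on inverse polynomials: the monomial of exponent `d`
sends the basis element indexed by `k` to the one indexed by `k - d` if `d ≤ k`, and to `0`
otherwise. -/
noncomputable def invPolyMul {K : Type u} [Field K] (a : PS K) : InvPoly K →+ InvPoly K :=
  Finsupp.liftAddHom fun k =>
    ∑ q ∈ Finset.HasAntidiagonal.antidiagonal k,
      (Finsupp.singleAddHom q.2).comp (AddMonoidHom.mulLeft (MvPowerSeries.coeff q.1 a))

theorem invPolyMul_single {K : Type u} [Field K] (a : PS K) (k : Fin 3 →₀ ℕ) (c : K) :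
    invPolyMul a (Finsupp.single k c) =
      ∑ q ∈ Finset.HasAntidiagonal.antidiagonal k,
        Finsupp.single q.2 (MvPowerSeries.coeff q.1 a * c) := by
  rw [invPolyMul, Finsupp.liftAddHom_apply_single, AddMonoidHom.finsetSum_apply]
  rfl

theorem invPoly_hom_ext {K : Type u} [Field K] {f g : InvPoly K →+ InvPoly K}
    (h : ∀ (k : Fin 3 →₀ ℕ) (c : K), f (Finsupp.single k c) =
      g (Finsupp.single k c)) : f = g :=
  Finsupp.addHom_ext h

theorem invPolyMul_one (K : Type u) [Field K] :
    invPolyMul (1 : PS K) = AddMonoidHom.id (InvPoly K) := by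
  classical
  refine invPoly_hom_ext fun k c => ?_
  rw [invPolyMul_single, Finset.sum_eq_single ((0, k) : (Fin 3 →₀ ℕ) × (Fin 3 →₀ ℕ))]
  · simp
  · rintro ⟨d, n⟩ hm hne
    rw [MvPowerSeries.coeff_one, if_neg, zero_mul, Finsupp.single_zero]
    rintro rfl
    simp_all
  · simp

theorem invPolyMul_add {K : Type u} [Field K] (a b : PS K) :
    invPolyMul (a + b) = invPolyMul a + invPolyMul b := by
  refine invPoly_hom_ext fun k c => ?_
  rw [AddMonoidHom.add_apply, invPolyMul_single, invPolyMul_single, invPolyMul_single]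
  refine Eq.trans ?_ Finset.sum_add_distrib
  refine Finset.sum_congr rfl fun q _ => ?_
  rw [map_add, add_mul, Finsupp.single_add]

theorem invPolyMul_mul {K : Type u} [Field K] (a b : PS K) :
    invPolyMul (a * b) = (invPolyMul a).comp (invPolyMul b) := by
  classical
  refine invPoly_hom_ext fun k c => ?_
  rw [AddMonoidHom.comp_apply, invPolyMul_single, invPolyMul_single]
  refine Eq.trans ?_ (map_sum (invPolyMul a) _ _).symm
  simp only [invPolyMul_single, MvPowerSeries.coeff_mul, Finset.sum_mul]
  have h : ∀ q : (Fin 3 →₀ ℕ) × (Fin 3 →₀ ℕ),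
      Finsupp.single q.2 (∑ r ∈ Finset.HasAntidiagonal.antidiagonal q.1,
        MvPowerSeries.coeff r.1 a * MvPowerSeries.coeff r.2 b * c) =
      ∑ r ∈ Finset.HasAntidiagonal.antidiagonal q.1,
        Finsupp.single q.2 (MvPowerSeries.coeff r.1 a * MvPowerSeries.coeff r.2 b * c) :=
    fun q => map_sum (Finsupp.singleAddHom q.2) _ _
  simp only [h]
  rw [Finset.sum_sigma']
  refine Eq.trans ?_ (Finset.sum_sigma' _ _ _).symm
  refine Finset.sum_nbij'
    (fun x => ⟨(x.2.2, x.2.1 + x.1.2), (x.2.1, x.1.2)⟩)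
    (fun x => ⟨(x.2.1 + x.1.1, x.2.2), (x.2.1, x.1.1)⟩) ?_ ?_ ?_ ?_ ?_
  · rintro ⟨⟨d, n⟩, ⟨r, s⟩⟩ hx
    simp only [Finset.mem_sigma, Finset.HasAntidiagonal.mem_antidiagonal] at hx ⊢
    refine ⟨?_, trivial⟩
    rw [← hx.1, ← hx.2]
    abel
  · rintro ⟨⟨d, n⟩, ⟨r, s⟩⟩ hx
    simp only [Finset.mem_sigma, Finset.HasAntidiagonal.mem_antidiagonal] at hx ⊢
    refine ⟨?_, trivial⟩
    rw [← hx.1, ← hx.2]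
    abel
  · rintro ⟨⟨d, n⟩, ⟨r, s⟩⟩ hx
    simp only [Finset.mem_sigma, Finset.HasAntidiagonal.mem_antidiagonal] at hx
    obtain ⟨-, rfl⟩ := hx
    rfl
  · rintro ⟨⟨d, n⟩, ⟨r, s⟩⟩ hx
    simp only [Finset.mem_sigma, Finset.HasAntidiagonal.mem_antidiagonal] at hx
    obtain ⟨-, rfl⟩ := hx
    rfl
  · rintro ⟨⟨d, n⟩, ⟨r, s⟩⟩ -
    simp only [mul_assoc]

noncomputable instance (K : Type u) [Field K] : Module (PS K) (InvPoly K) where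
  smul a m := invPolyMul a m
  one_smul m := DFunLike.congr_fun (invPolyMul_one K) m
  mul_smul a b m := DFunLike.congr_fun (invPolyMul_mul a b) m
  smul_zero a := map_zero (invPolyMul a)
  smul_add a := map_add (invPolyMul a)
  add_smul a b m := DFunLike.congr_fun (invPolyMul_add a b) m
  zero_smul m := by
    have h := DFunLike.congr_fun (invPolyMul_add (0 : PS K) 0) m
    rw [add_zero, AddMonoidHom.add_apply] at h
    exact left_eq_add.mp h

/-- The standard Frobenius map on inverse polynomials, in unshifted exponents
`c x^(-α) y^(-β) z^(-γ) ↦ c^p x^(-p α) y^(-p β) z^(-p γ)`;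
on shifted exponents `n = α - 1` this is `n ↦ p (n + 1) - 1 = p n + (p - 1)`. -/
noncomputable def stdFrob (K : Type u) [Field K] (p : ℕ) [Fact p.Prime] [CharP K p] :
    AddMonoid.End (InvPoly K) :=
  Finsupp.liftAddHom fun n =>
    (Finsupp.singleAddHom (p • n + Finsupp.equivFunOnFinite.symm fun _ => p - 1)).comp
      (frobenius K p).toAddMonoidHom

/-- `E_S` for `S = K⟦x, y, z⟧ / I`: the inverse polynomials annihilated by `I`. -/
noncomputable abbrev hull {K : Type u} [Field K] (I : Ideal (PS K)) : Submodule (PS K) (InvPoly K) :=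
  Submodule.torsionBySet (PS K) (InvPoly K) (I : Set (PS K))

end InversePolynomials

end FrobeniusMaps

/-! Everything rests on the fact that the `p ^ e`-Frobenius maps of `E_S` are exactly `m ↦ a f^e(m)`
with `a ∈ K_e` (`smul_stdFrob_pow_mem_hull`, `exists_eq_smul_stdFrob_pow`). The coefficient `a` need
not be unique, but only its existence is used.

Since `f^i b = b^(p^i) f^i`, the composite of `a f^i` and `b f^j` is `a b^(p^i) f^(i+j)`. Hence
multiplying generators multiplies colon ideals with the Frobenius twists seen in `L_e`. For one
inclusion, closure induction shows that each degree `d` component of an element generated in degrees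
`< e` has a coefficient in the analogous sum `lIdealLT p I e d`. For the other, the coefficients of
generated maps form an ideal, because all scalars lie in degree zero, and this ideal contains every
product of colon ideals.

The representation of Frobenius maps is proved by comparing coefficients: a coefficient series is
read off from the values on monomials, and a finite-dimensional duality argument shows that the
annihilator of `f^e(E_S)` lies in `I^[p^e]`. Injectivity of `E` comes from Baer's criterion,
Artin–Rees and the residue functional. -/

namespace FrobeniusMaps

/-! ### Power series acting on inverse polynomials -/

section Action

variable {K : Type u} [Field K]

theorem smul_single_apply (a : PS K) (k : Fin 3 →₀ ℕ) (c : K) (n : Fin 3 →₀ ℕ) :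
    (a • (Finsupp.single k c : InvPoly K)) n =
      (if n ≤ k then MvPowerSeries.coeff (k - n) a else 0) * c := by
  classical
  change (invPolyMul a (Finsupp.single k c)) n = _
  rw [invPolyMul_single, Finsupp.finsetSum_apply]
  split_ifs with h
  · rw [Finset.sum_eq_single (k - n, n)]
    · simp
    · rintro ⟨d, m⟩ hm hne
      rw [Finset.HasAntidiagonal.mem_antidiagonal] at hm
      refine Finsupp.single_eq_of_ne ?_
      rintro rfl
      exact hne (by rw [← hm]; simp)
    · intro hm
      exact absurd (Finset.HasAntidiagonal.mem_antidiagonal.2 (tsub_add_cancel_of_le h)) hm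
  · rw [zero_mul]
    refine Finset.sum_eq_zero ?_
    rintro ⟨d, m⟩ hm
    rw [Finset.HasAntidiagonal.mem_antidiagonal] at hm
    refine Finsupp.single_eq_of_ne ?_
    rintro rfl
    exact h (by rw [← hm]; simp)

theorem smul_apply (a : PS K) (m : InvPoly K) (n : Fin 3 →₀ ℕ) :
    (a • m) n = m.sum fun k c => (if n ≤ k then MvPowerSeries.coeff (k - n) a else 0) * c := by
  induction m using Finsupp.induction_linear with
  | zero => simp
  | add f g hf hg =>
    rw [smul_add, Finsupp.add_apply, hf, hg, Finsupp.sum_add_index' (by simp)]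
    intro k b₁ b₂
    rw [mul_add]
  | single k c => rw [smul_single_apply, Finsupp.sum_single_index (by simp)]

theorem smul_apply_zero (a : PS K) (m : InvPoly K) :
    (a • m) 0 = m.sum fun k c => MvPowerSeries.coeff k a * c := by
  simp [smul_apply]

theorem monomial_smul_apply (n : Fin 3 →₀ ℕ) (m : InvPoly K) (j : Fin 3 →₀ ℕ) :
    (MvPowerSeries.monomial n (1 : K) • m) j = m (n + j) := by
  classical
  induction m using Finsupp.induction_linear with
  | zero => simp
  | add f g hf hg => rw [smul_add, Finsupp.add_apply, hf, hg, Finsupp.add_apply]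
  | single k c =>
    rw [smul_single_apply, MvPowerSeries.coeff_monomial, Finsupp.single_apply]
    by_cases h : k = n + j
    · subst h; simp
    · rw [if_neg h]
      by_cases hj : j ≤ k
      · rw [if_pos hj, if_neg, zero_mul]
        intro h'
        exact h (by rw [← h', tsub_add_cancel_of_le hj])
      · rw [if_neg hj, zero_mul]

/-- Reduces vanishing of `a • m` for all `a` in an ideal to vanishing of the coefficient at exponent
`0`. -/
theorem smul_apply_eq_monomial_mul_smul_apply_zero (a : PS K) (m : InvPoly K) (n : Fin 3 →₀ ℕ) :
    (a • m) n = ((MvPowerSeries.monomial n (1 : K) * a) • m) 0 := by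
  rw [mul_smul, monomial_smul_apply, add_zero]

theorem C_smul (c : K) (m : InvPoly K) : (MvPowerSeries.C c : PS K) • m = c • m := by
  classical
  induction m using Finsupp.induction_linear with
  | zero => simp
  | add f g hf hg => rw [smul_add, hf, hg, smul_add]
  | single k d =>
    ext n
    rw [smul_single_apply, Finsupp.smul_single, Finsupp.single_apply, MvPowerSeries.coeff_C,
      smul_eq_mul]
    by_cases h : k = n
    · subst h; simp
    · rw [if_neg h]
      by_cases hn : n ≤ k
      · rw [if_pos hn, if_neg, zero_mul]
        intro h'
        exact h (le_antisymm (tsub_eq_zero_iff_le.1 h') hn)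
      · rw [if_neg hn, zero_mul]

instance : IsScalarTower K (PS K) (InvPoly K) :=
  IsScalarTower.of_algebraMap_smul fun c m => C_smul c m

theorem mem_hull {I : Ideal (PS K)} {m : InvPoly K} : m ∈ hull I ↔ ∀ u ∈ I, u • m = 0 := by
  simp [hull, Submodule.mem_torsionBySet_iff]

end Action

/-! ### Iterates of the standard Frobenius -/

section Frobenius

theorem primePow_pos (p : ℕ) [hp : Fact p.Prime] (e : ℕ) : 0 < p ^ e := pow_pos hp.out.pos e

/-- The exponent all of whose entries are `p ^ e - 1`. -/
noncomputable def topExp (p e : ℕ) : Fin 3 →₀ ℕ :=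
  Finsupp.equivFunOnFinite.symm fun _ => p ^ e - 1

theorem topExp_apply (p e : ℕ) (i : Fin 3) : topExp p e i = p ^ e - 1 := rfl

variable {K : Type u} [Field K] (p : ℕ) [Fact p.Prime] [CharP K p]

theorem stdFrob_single (k : Fin 3 →₀ ℕ) (c : K) :
    stdFrob K p (Finsupp.single k c) =
      Finsupp.single (p • k + Finsupp.equivFunOnFinite.symm fun _ => p - 1) (c ^ p) :=
  Finsupp.liftAddHom_apply_single _ _ _

theorem stdFrob_pow_single (e : ℕ) (k : Fin 3 →₀ ℕ) (c : K) :
    (stdFrob K p ^ e) (Finsupp.single k c) =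
      Finsupp.single (p ^ e • k + topExp p e) (c ^ p ^ e) := by
  induction e with
  | zero =>
    have : topExp p 0 = 0 := by ext i; simp [topExp]
    simp [this]
  | succ e ih =>
    rw [pow_succ', AddMonoid.End.coe_mul, Function.comp_apply, ih, stdFrob_single, ← pow_mul,
      ← pow_succ]
    congr 1
    ext i
    have h1 := primePow_pos p e
    have h2 := primePow_pos p (e + 1)
    have h3 := (Fact.out : p.Prime).pos
    obtain ⟨t, ht⟩ : ∃ t, p ^ e = t + 1 := ⟨p ^ e - 1, by omega⟩
    obtain ⟨s, rfl⟩ : ∃ s, p = s + 1 := ⟨p - 1, by omega⟩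
    have h4 : (s + 1) ^ (e + 1) - 1 = (s + 1) * t + s := by
      have : (t + 1) * (s + 1) = (s + 1) * t + s + 1 := by ring
      rw [pow_succ, ht]; omega
    simp only [Finsupp.add_apply, Finsupp.smul_apply, topExp_apply, smul_eq_mul,
      Finsupp.equivFunOnFinite_symm_apply_apply, h4]
    rw [pow_succ, ht]
    simp
    ring

theorem stdFrob_pow_add (d e : ℕ) (m : InvPoly K) :
    (stdFrob K p ^ (d + e)) m = (stdFrob K p ^ d) ((stdFrob K p ^ e) m) := by
  rw [pow_add]; rfl

theorem coeff_pow_smul (e : ℕ) (a : PS K) (k : Fin 3 →₀ ℕ) :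
    MvPowerSeries.coeff (p ^ e • k) (a ^ p ^ e) = MvPowerSeries.coeff k a ^ p ^ e := by
  rw [← MvPowerSeries.map_iterateFrobenius_expand p (Fact.out : p.Prime).ne_zero a e,
    MvPowerSeries.coeff_map, MvPowerSeries.coeff_expand_smul, iterateFrobenius_def]

theorem coeff_pow_of_not_dvd (e : ℕ) (a : PS K) {k : Fin 3 →₀ ℕ} {i : Fin 3}
    (h : ¬ p ^ e ∣ k i) : MvPowerSeries.coeff k (a ^ p ^ e) = 0 := by
  rw [← MvPowerSeries.map_iterateFrobenius_expand p (Fact.out : p.Prime).ne_zero a e,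
    MvPowerSeries.coeff_map, MvPowerSeries.coeff_expand_of_not_dvd _ _ _ h, map_zero]

theorem stdFrob_pow_smul (e : ℕ) (a : PS K) (m : InvPoly K) :
    (stdFrob K p ^ e) (a • m) = a ^ p ^ e • (stdFrob K p ^ e) m := by
  classical
  have hq := primePow_pos p e
  induction m using Finsupp.induction_linear with
  | zero => simp
  | add f g hf hg => rw [smul_add, map_add, hf, hg, map_add, smul_add]
  | single k c =>
    have h : a • (Finsupp.single k c : InvPoly K) = ∑ q ∈ Finset.HasAntidiagonal.antidiagonal k,
        Finsupp.single q.2 (MvPowerSeries.coeff q.1 a * c) := invPolyMul_single a k c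
    rw [h, map_sum]
    simp only [stdFrob_pow_single]
    ext n
    rw [smul_single_apply, Finsupp.finsetSum_apply]
    by_cases hn : ∃ j, j ≤ k ∧ n = p ^ e • j + topExp p e
    · obtain ⟨j, hj, rfl⟩ := hn
      rw [Finset.sum_eq_single (k - j, j)]
      · rw [Finsupp.single_eq_same, if_pos (by gcongr), add_tsub_add_eq_tsub_right]
        have : p ^ e • k - p ^ e • j = p ^ e • (k - j) := by
          ext i; simp [Nat.mul_sub]
        rw [this, coeff_pow_smul, mul_pow]
      · rintro ⟨d, m⟩ hm hne
        rw [Finset.HasAntidiagonal.mem_antidiagonal] at hm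
        refine Finsupp.single_eq_of_ne ?_
        intro h'
        have : j = m := by
          ext i
          have := DFunLike.congr_fun h' i
          simp only [Finsupp.add_apply, Finsupp.smul_apply, smul_eq_mul] at this
          exact Nat.eq_of_mul_eq_mul_left hq (by omega)
        subst this
        exact hne (by rw [← hm]; simp)
      · intro hm
        exact absurd (Finset.HasAntidiagonal.mem_antidiagonal.2 (tsub_add_cancel_of_le hj)) hm
    · rw [Finset.sum_eq_zero, eq_comm, mul_eq_zero]
      · left
        split_ifs with hle
        -- A nonzero coefficient of `a ^ p ^ e` has all exponents divisible by `p ^ e`; this would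
        -- give `n` the excluded form.
        · by_contra hc
          have hdvd : ∀ i, p ^ e ∣ (p ^ e • k + topExp p e - n) i := fun i => by
            by_contra hi
            exact hc (coeff_pow_of_not_dvd p e a hi)
          choose g hg using hdvd
          refine hn ⟨k - Finsupp.equivFunOnFinite.symm g, tsub_le_self, ?_⟩
          ext i
          have h1 := hg i
          have h2 := hle i
          simp only [Finsupp.add_apply, Finsupp.smul_apply, Finsupp.tsub_apply, topExp_apply,
            smul_eq_mul, Finsupp.equivFunOnFinite_symm_apply_apply] at h1 h2 ⊢
          rw [Nat.mul_sub]
          have h3 : g i ≤ k i := by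
            by_contra h3
            have : p ^ e * (k i + 1) ≤ p ^ e * g i := Nat.mul_le_mul_left _ (by omega)
            rw [mul_add] at this
            omega
          have := Nat.mul_le_mul_left (p ^ e) h3
          omega
        · rfl
      · rintro ⟨d, m⟩ hm
        rw [Finset.HasAntidiagonal.mem_antidiagonal] at hm
        refine Finsupp.single_eq_of_ne ?_
        rintro rfl
        exact hn ⟨m, by rw [← hm]; simp, rfl⟩

end Frobenius

/-! ### The adic topology and injectivity of `E` -/

section Adic

variable {K : Type u} [Field K]

open IsLocalRing

theorem X_mem_maximalIdeal (i : Fin 3) : (MvPowerSeries.X i : PS K) ∈ maximalIdeal (PS K) := by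
  rw [mem_maximalIdeal, mem_nonunits_iff, MvPowerSeries.isUnit_iff_constantCoeff]
  simp

theorem mem_maximalIdeal_pow_of_coeff {N : ℕ} (s : Finset (Fin 3)) :
    ∀ f : PS K, (∀ n : Fin 3 →₀ ℕ, (∀ i ∈ s, n i < N) → MvPowerSeries.coeff n f = 0) →
      f ∈ maximalIdeal (PS K) ^ N := by
  classical
  induction s using Finset.induction_on with
  | empty =>
    intro f hf
    have : f = 0 := MvPowerSeries.ext fun n => by rw [hf n (by simp)]; simp
    rw [this]
    exact zero_mem _
  | insert a s has ih =>
    intro f hf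
    -- `g` keeps the terms of degree `< N` in the variable `a`, so `f - g` is divisible by the
    -- `N`-th power of that variable, while `g` falls under the induction hypothesis.
    let g : PS K := fun n => if n a < N then MvPowerSeries.coeff n f else 0
    have hg : ∀ n, MvPowerSeries.coeff n g = if n a < N then MvPowerSeries.coeff n f else 0 :=
      fun n => rfl
    have h1 : g ∈ maximalIdeal (PS K) ^ N := by
      refine ih g fun n hn => ?_
      rw [hg]
      split_ifs with h
      · refine hf n fun i hi => ?_
        rcases Finset.mem_insert.1 hi with rfl | hi
        · exact h
        · exact hn i hi
      · rfl
    have h2 : (MvPowerSeries.X a : PS K) ^ N ∣ f - g := by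
      rw [MvPowerSeries.X_pow_dvd_iff]
      intro n hn
      rw [map_sub, hg, if_pos hn, sub_self]
    have h3 : f - g ∈ maximalIdeal (PS K) ^ N :=
      Ideal.mem_of_dvd _ h2 (Ideal.pow_mem_pow (X_mem_maximalIdeal a) N)
    simpa using add_mem h3 h1

/-- The exponent all of whose entries are `N`. -/
noncomputable def constExp (N : ℕ) : Fin 3 →₀ ℕ := Finsupp.equivFunOnFinite.symm fun _ => N

theorem mem_maximalIdeal_pow {N : ℕ} {f : PS K}
    (h : ∀ n ≤ constExp N, MvPowerSeries.coeff n f = 0) : f ∈ maximalIdeal (PS K) ^ N :=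
  mem_maximalIdeal_pow_of_coeff Finset.univ f fun n hn =>
    h n fun i => (hn i (Finset.mem_univ i)).le

/-- Krull's intersection theorem for `R / J`: ideals are closed, so membership may be tested on
finite boxes of exponents. -/
theorem mem_ideal_of_forall_coeff {J : Ideal (PS K)} {b : PS K}
    (h : ∀ d : Fin 3 →₀ ℕ, ∃ b' ∈ J, ∀ n ≤ d, MvPowerSeries.coeff n (b - b') = 0) : b ∈ J := by
  have hk := Ideal.iInf_pow_smul_eq_bot_of_isLocalRing (M := PS K ⧸ J) (maximalIdeal (PS K))
    (maximalIdeal.isMaximal _).ne_top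
  have hb : Submodule.Quotient.mk (p := J) b ∈
      (⨅ i : ℕ, maximalIdeal (PS K) ^ i • ⊤ : Submodule (PS K) (PS K ⧸ J)) := by
    rw [Submodule.mem_iInf]
    intro i
    obtain ⟨b', hb', hc⟩ := h (constExp i)
    have h1 : Submodule.Quotient.mk (p := J) b =
        (b - b') • Submodule.Quotient.mk (p := J) (1 : PS K) := by
      rw [← Submodule.Quotient.mk_smul, smul_eq_mul, mul_one, Submodule.Quotient.eq]
      simpa using hb'
    rw [h1]
    exact Submodule.smul_mem_smul (mem_maximalIdeal_pow hc) trivial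
  rw [hk, Submodule.mem_bot, Submodule.Quotient.mk_eq_zero] at hb
  exact hb

/-- The polynomial of the terms of `r` with exponent at most `d`. -/
noncomputable def truncSum (d : Fin 3 →₀ ℕ) (r : PS K) : PS K :=
  ∑ k ∈ Finset.Iic d, MvPowerSeries.monomial k (MvPowerSeries.coeff k r)

theorem coeff_truncSum (d : Fin 3 →₀ ℕ) (r : PS K) (n : Fin 3 →₀ ℕ) (hn : n ≤ d) :
    MvPowerSeries.coeff n (truncSum d r) = MvPowerSeries.coeff n r := by
  classical
  rw [truncSum, map_sum, Finset.sum_eq_single n]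
  · rw [MvPowerSeries.coeff_monomial, if_pos rfl]
  · intro k _ hk
    rw [MvPowerSeries.coeff_monomial, if_neg hk.symm]
  · intro h
    exact absurd (Finset.mem_Iic.2 hn) h

theorem X_pow_smul_eq_zero (m : InvPoly K) (i : Fin 3) :
    ∃ N : ℕ, (MvPowerSeries.X i : PS K) ^ N • m = 0 := by
  refine ⟨m.support.sup (fun n => n i) + 1, ?_⟩
  ext j
  rw [MvPowerSeries.X_pow_eq, monomial_smul_apply, Finsupp.zero_apply]
  by_contra h
  have := Finset.le_sup (f := fun n : Fin 3 →₀ ℕ => n i) (Finsupp.mem_support_iff.2 h)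
  simp only [Finsupp.add_apply, Finsupp.single_eq_same] at this
  omega

theorem maximalIdeal_le_span_X :
    maximalIdeal (PS K) ≤ Ideal.span (Set.range fun i => (MvPowerSeries.X i : PS K)) := by
  intro f hf
  refine mem_ideal_of_forall_coeff (J := Ideal.span _) fun d => ⟨truncSum d f, ?_, fun n hn => ?_⟩
  · refine sum_mem fun k _ => ?_
    by_cases hk : k = 0
    · subst hk
      rw [mem_maximalIdeal, mem_nonunits_iff, MvPowerSeries.isUnit_iff_constantCoeff] at hf
      simp only [isUnit_iff_ne_zero, not_not] at hf
      rw [MvPowerSeries.coeff_zero_eq_constantCoeff_apply, hf, map_zero]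
      exact zero_mem _
    · obtain ⟨i, hi⟩ := DFunLike.ne_iff.1 hk
      refine Ideal.mem_of_dvd _ ?_ (Ideal.subset_span ⟨i, rfl⟩)
      classical
      rw [MvPowerSeries.X_dvd_iff]
      intro n hn
      rw [MvPowerSeries.coeff_monomial, if_neg]
      rintro rfl
      exact hi hn
  · rw [map_sub, coeff_truncSum d f n hn, sub_self]

/-- Each variable acts nilpotently on each element, so the maximal ideal lies in the radical of the
annihilator of any single element. -/
theorem exists_maximalIdeal_pow_le_annihilator (U : Submodule (PS K) (InvPoly K)) (hU : U.FG) :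
    ∃ N : ℕ, maximalIdeal (PS K) ^ N ≤ U.annihilator := by
  induction U, hU using Submodule.fg_induction with
  | singleton m =>
    refine Ideal.exists_pow_le_of_le_radical_of_fg (maximalIdeal_le_span_X.trans ?_)
      (IsNoetherian.noetherian _)
    rw [Ideal.span_le]
    rintro _ ⟨i, rfl⟩
    obtain ⟨N, hN⟩ := X_pow_smul_eq_zero m i
    exact ⟨N, (Submodule.mem_annihilator_span_singleton _ _).2 hN⟩
  | sup U₁ U₂ _ _ ih₁ ih₂ =>
    obtain ⟨N₁, h₁⟩ := ih₁
    obtain ⟨N₂, h₂⟩ := ih₂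
    refine ⟨max N₁ N₂, ?_⟩
    rw [Submodule.annihilator_sup]
    exact le_inf ((Ideal.pow_le_pow_right (le_max_left _ _)).trans h₁)
      ((Ideal.pow_le_pow_right (le_max_right _ _)).trans h₂)

/-- Taking the coefficient of `x⁻¹ y⁻¹ z⁻¹`. -/
noncomputable def res (K : Type u) [Field K] : InvPoly K →ₗ[K] K := Finsupp.lapply 0

theorem res_apply (m : InvPoly K) : res K m = m 0 := rfl

theorem ext_res {m m' : InvPoly K} (h : ∀ a : PS K, res K (a • m) = res K (a • m')) : m = m' := by
  ext n
  simpa [res_apply, monomial_smul_apply] using h (MvPowerSeries.monomial n 1)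

/-- The coefficients of `m` are the values of `μ` on monomials. Finitely many are nonzero, because
monomials outside a box lie in the `N`-th power of the maximal ideal. -/
theorem exists_res_smul_eq {N : ℕ}
    (μ : (PS K ⧸ (maximalIdeal (PS K) ^ N : Ideal (PS K))) →ₗ[K] K) :
    ∃ m : InvPoly K, ∀ r : PS K, res K (r • m) = μ (Ideal.Quotient.mk _ r) := by
  classical
  have h0 : ∀ n, μ (Ideal.Quotient.mk _ (MvPowerSeries.monomial n 1)) ≠ 0 →
      n ∈ Finset.Iic (constExp N) := by
    intro n hn
    by_contra hlt
    apply hn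
    rw [Ideal.Quotient.eq_zero_iff_mem.2, map_zero]
    refine mem_maximalIdeal_pow fun k hk => ?_
    rw [MvPowerSeries.coeff_monomial, if_neg]
    rintro rfl
    exact hlt (Finset.mem_Iic.2 hk)
  refine ⟨Finsupp.onFinset _ _ h0, fun r => ?_⟩
  have h1 : Ideal.Quotient.mk (maximalIdeal (PS K) ^ N) r =
      Ideal.Quotient.mk _ (truncSum (constExp N) r) := by
    rw [Ideal.Quotient.eq]
    refine mem_maximalIdeal_pow fun n hn => ?_
    rw [map_sub, coeff_truncSum _ r n hn, sub_self]
  rw [h1, truncSum, map_sum, map_sum, res_apply, smul_apply_zero,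
    Finsupp.onFinset_sum _ (by simp)]
  refine Finset.sum_congr rfl fun k _ => ?_
  rw [← smul_eq_mul, ← map_smul]
  congr 1
  rw [← Ideal.Quotient.mkₐ_eq_mk K, ← map_smul, ← map_smul, smul_eq_mul, mul_one]

theorem invPoly_baer : Module.Baer (PS K) (InvPoly K) := by
  intro J g
  obtain ⟨n, hn⟩ := exists_maximalIdeal_pow_le_annihilator (LinearMap.range g)
    (by rw [LinearMap.range_eq_map]; exact (IsNoetherian.noetherian (⊤ : Submodule _ J)).map g)
  -- Artin–Rees: elements of `J` deep in the adic filtration are combinations, with coefficients in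
  -- the `n`-th power, of elements of `J`; `g` kills them.
  obtain ⟨k, hk⟩ := Ideal.exists_pow_inf_eq_pow_smul (maximalIdeal (PS K)) J
  have hker : ∀ x (hx : x ∈ J), x ∈ maximalIdeal (PS K) ^ (n + k) → g ⟨x, hx⟩ = 0 := by
    intro x hx hx'
    have h1 : x ∈ maximalIdeal (PS K) ^ (n + k) • (⊤ : Ideal (PS K)) ⊓ J :=
      ⟨by simpa using hx', hx⟩
    rw [hk (n + k) (by omega), Nat.add_sub_cancel] at h1
    have h2 : ∃ h : x ∈ J, g ⟨x, h⟩ = 0 := by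
      refine Submodule.smul_induction_on h1 ?_ ?_
      · intro r hr y hy
        refine ⟨J.smul_mem r hy.2, ?_⟩
        have : g ⟨r • y, J.smul_mem r hy.2⟩ = r • g ⟨y, hy.2⟩ := by rw [← map_smul]; rfl
        rw [this]
        exact Submodule.mem_annihilator.1 (hn hr) _ ⟨_, rfl⟩
      · rintro y z ⟨hy, hy'⟩ ⟨hz, hz'⟩
        refine ⟨J.add_mem hy hz, ?_⟩
        have : g ⟨y + z, J.add_mem hy hz⟩ = g ⟨y, hy⟩ + g ⟨z, hz⟩ := by rw [← map_add]; rfl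
        rw [this, hy', hz', add_zero]
    exact h2.2
  let f : J →ₗ[K] PS K ⧸ (maximalIdeal (PS K) ^ (n + k) : Ideal (PS K)) :=
    (Ideal.Quotient.mkₐ K _).toLinearMap ∘ₗ (Submodule.subtype J).restrictScalars K
  -- The functional `res ∘ g` vanishes on the kernel of `f`, so it extends to a functional on the
  -- quotient of `R`, which an inverse polynomial represents.
  have hl : res K ∘ₗ g.restrictScalars K ∈ LinearMap.range f.dualMap := by
    rw [LinearMap.range_dualMap_eq_dualAnnihilator_ker, Submodule.mem_dualAnnihilator]
    rintro ⟨x, hx⟩ hx'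
    have h1 : x ∈ maximalIdeal (PS K) ^ (n + k) := Ideal.Quotient.eq_zero_iff_mem.1 hx'
    simp [hker x hx h1]
  obtain ⟨μ, hμ⟩ := hl
  obtain ⟨m, hm⟩ := exists_res_smul_eq μ
  refine ⟨LinearMap.toSpanSingleton _ _ m, fun x hx => ext_res fun a => ?_⟩
  rw [LinearMap.toSpanSingleton_apply, ← mul_smul, hm]
  have h1 := LinearMap.congr_fun hμ ⟨a * x, J.mul_mem_left a hx⟩
  have h2 : g ⟨a * x, J.mul_mem_left a hx⟩ = a • g ⟨x, hx⟩ := by rw [← map_smul]; rfl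
  change μ _ = res K (g _) at h1
  rw [h2] at h1
  exact h1

instance invPoly_injective : Module.Injective (PS K) (InvPoly K) := invPoly_baer.injective

end Adic

/-! ### Injective hulls of residue fields -/

section Hull

open IsLocalRing

theorem isInjectiveHull_residueField {A : Type u} [CommRing A] [IsLocalRing A] {M : Type u}
    [AddCommGroup M] [Module A M] (hM : Module.Injective A M) (v : M) (hv : v ≠ 0)
    (hann : ∀ a ∈ maximalIdeal A, a • v = 0)
    (hess : ∀ m : M, m ≠ 0 → ∃ a b : A, a • m = b • v ∧ a • m ≠ 0) :
    IsInjectiveHull A (ResidueField A) M := by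
  let j : ResidueField A →ₗ[A] M :=
    Submodule.liftQ (maximalIdeal A) (LinearMap.toSpanSingleton A M v) fun a ha => by
      simpa using hann a ha
  have hj : ∀ a : A, j (Submodule.Quotient.mk a) = a • v := fun a => rfl
  refine ⟨hM, j, ?_, ?_⟩
  · rw [injective_iff_map_eq_zero]
    intro x hx
    obtain ⟨a, rfl⟩ := Submodule.Quotient.mk_surjective _ x
    rw [hj] at hx
    refine (Submodule.Quotient.mk_eq_zero _).2 ?_
    rw [mem_maximalIdeal, mem_nonunits_iff]
    intro ha
    exact hv ((ha.smul_eq_zero).1 hx)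
  · intro U hU h
    obtain ⟨m, hm, hm0⟩ := (Submodule.ne_bot_iff _).1 hU
    obtain ⟨a, b, hab, h0⟩ := hess m hm0
    have : a • m ∈ U ⊓ LinearMap.range j :=
      ⟨U.smul_mem a hm, ⟨Submodule.Quotient.mk b, by rw [hj, hab]⟩⟩
    rw [h, Submodule.mem_bot] at this
    exact h0 this

variable {K : Type u} [Field K]

theorem maximalIdeal_smul_single_zero {a : PS K} (ha : a ∈ maximalIdeal (PS K)) (c : K) :
    a • (Finsupp.single 0 c : InvPoly K) = 0 := by
  rw [mem_maximalIdeal, mem_nonunits_iff, MvPowerSeries.isUnit_iff_constantCoeff] at ha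
  simp only [isUnit_iff_ne_zero, not_not] at ha
  ext n
  rw [smul_single_apply]
  split_ifs with h
  · obtain rfl : n = 0 := le_antisymm h (zero_le)
    simp [ha]
  · simp

theorem exists_monomial_smul_eq_single (m : InvPoly K) (hm : m ≠ 0) :
    ∃ (k : Fin 3 →₀ ℕ) (c : K), c ≠ 0 ∧
      MvPowerSeries.monomial k (1 : K) • m = Finsupp.single 0 c := by
  classical
  -- Shifting down by a maximal exponent of the support leaves only the term at `0`.
  obtain ⟨k, hk⟩ := m.support.exists_maximal (Finsupp.support_nonempty_iff.2 hm)
  refine ⟨k, m k, Finsupp.mem_support_iff.1 hk.prop, ?_⟩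
  ext j
  rw [monomial_smul_apply, Finsupp.single_apply]
  split_ifs with h
  · rw [← h, add_zero]
  · by_contra h'
    have h1 := hk.le_of_ge (Finsupp.mem_support_iff.2 h') (le_self_add)
    apply h
    refine (le_antisymm ?_ zero_le).symm
    simpa using h1

theorem exists_smul_eq_smul_single_zero (m : InvPoly K) (hm : m ≠ 0) :
    ∃ a b : PS K, a • m = b • (Finsupp.single 0 1 : InvPoly K) ∧ a • m ≠ 0 := by
  obtain ⟨k, c, hc, h⟩ := exists_monomial_smul_eq_single m hm
  refine ⟨MvPowerSeries.monomial k 1, MvPowerSeries.C c, ?_, ?_⟩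
  · rw [h, C_smul, Finsupp.smul_single, smul_eq_mul, mul_one]
  · rw [h]
    simpa using hc

theorem invPoly_isInjectiveHull :
    IsInjectiveHull (PS K) (ResidueField (PS K)) (InvPoly K) :=
  isInjectiveHull_residueField invPoly_injective (Finsupp.single 0 1) (by simp)
    (fun _ ha => maximalIdeal_smul_single_zero ha 1) exists_smul_eq_smul_single_zero

/-- Extend into `E` over `R`; as `I` kills the source `Y`, the extension lands in the part of `E`
killed by `I`. -/
theorem hull_injective (I : Ideal (PS K)) : Module.Injective (PS K ⧸ I) (hull I) := by
  refine ⟨fun X Y _ _ _ _ f hf g => ?_⟩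
  let _ : Module (PS K) X := Module.compHom X (Ideal.Quotient.mk I)
  let _ : Module (PS K) Y := Module.compHom Y (Ideal.Quotient.mk I)
  let f' : X →ₗ[PS K] Y :=
    { toFun := f, map_add' := map_add f, map_smul' := fun r x => map_smul f (Ideal.Quotient.mk I r) x }
  let g' : X →ₗ[PS K] InvPoly K :=
    { toFun := fun x => g x
      map_add' := fun x y => by rw [map_add]; rfl
      map_smul' := fun r x => by
        have := map_smul g (Ideal.Quotient.mk I r) x
        rw [Submodule.torsionBySet.mk_smul] at this
        exact congrArg Subtype.val this }
  obtain ⟨h, hh⟩ := Module.Injective.out f' hf g'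
  have hmem : ∀ y, h y ∈ hull I := fun y => mem_hull.2 fun u hu => by
    rw [← map_smul]
    have : u • y = 0 := by
      change Ideal.Quotient.mk I u • y = 0
      rw [Ideal.Quotient.eq_zero_iff_mem.2 hu]
      exact zero_smul (PS K ⧸ I) y
    rw [this, map_zero]
  refine ⟨{ toFun := fun y => ⟨h y, hmem y⟩, map_add' := ?_, map_smul' := ?_ }, ?_⟩
  · intro x y
    exact Subtype.ext (map_add h x y)
  · intro s y
    obtain ⟨r, rfl⟩ := Ideal.Quotient.mk_surjective s
    exact Subtype.ext (map_smul h r y)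
  · intro x
    exact Subtype.ext (hh x)

theorem hull_isInjectiveHull (I : Ideal (PS K)) [IsLocalRing (PS K ⧸ I)] (hI : I ≠ ⊤) :
    IsInjectiveHull (PS K ⧸ I) (ResidueField (PS K ⧸ I)) (hull I) := by
  have hmem : (Finsupp.single 0 1 : InvPoly K) ∈ hull I := mem_hull.2 fun u hu =>
    maximalIdeal_smul_single_zero (le_maximalIdeal hI hu) 1
  refine isInjectiveHull_residueField (hull_injective I) ⟨_, hmem⟩ ?_ ?_ ?_
  · intro h
    simpa using congrArg Subtype.val h
  · intro a ha
    obtain ⟨r, rfl⟩ := Ideal.Quotient.mk_surjective a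
    rw [Submodule.torsionBySet.mk_smul]
    refine Subtype.ext (maximalIdeal_smul_single_zero ?_ 1)
    rw [mem_maximalIdeal, mem_nonunits_iff] at ha ⊢
    exact fun h => ha (h.map _)
  · intro m hm
    obtain ⟨a, b, h1, h2⟩ := exists_smul_eq_smul_single_zero (m : InvPoly K)
      (fun h => hm (Subtype.ext h))
    refine ⟨Ideal.Quotient.mk I a, Ideal.Quotient.mk I b, ?_, ?_⟩
    · rw [Submodule.torsionBySet.mk_smul, Submodule.torsionBySet.mk_smul]
      exact Subtype.ext h1
    · rw [Submodule.torsionBySet.mk_smul]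
      exact fun h => h2 (congrArg Subtype.val h)

theorem isLocalRing_quotient {A : Type u} [CommRing A] [IsLocalRing A] {I : Ideal A}
    (hI : I ≠ ⊤) : IsLocalRing (A ⧸ I) :=
  have := Ideal.Quotient.nontrivial_iff.2 hI
  IsLocalRing.of_surjective' _ Ideal.Quotient.mk_surjective

end Hull

/-! ### Frobenius maps of `E_S` as multiples of `f^e` -/

section Representation

theorem frobMaps_apply_smul {K : Type u} [Field K] {p : ℕ} {I : Ideal (PS K)} {e : ℕ}
    {φ : AddMonoid.End (hull I)}
    (hφ : φ ∈ frobMaps (PS K ⧸ I) p (hull I) e) (a : PS K) (m : hull I) :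
    φ (a • m) = a ^ p ^ e • φ m := by
  have := hφ (Ideal.Quotient.mk I a) m
  rwa [← map_pow, Submodule.torsionBySet.mk_smul, Submodule.torsionBySet.mk_smul] at this

theorem exists_projection {K : Type u} [Field K] {V : Type*} [AddCommGroup V] [Module K V] (W : Submodule K V) :
    ∃ P : V →ₗ[K] W, ∀ w : W, P w = w := by
  obtain ⟨P, hP⟩ := LinearMap.exists_leftInverse_of_injective W.subtype W.ker_subtype
  exact ⟨P, fun w => LinearMap.congr_fun hP w⟩

variable {K : Type u} [Field K] (p : ℕ) [Fact p.Prime] [CharP K p]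

theorem exists_eq_smul_add (e : ℕ) (n : Fin 3 →₀ ℕ) :
    ∃ k r : Fin 3 →₀ ℕ, k ≤ n ∧ r ≤ topExp p e ∧ n = p ^ e • k + r := by
  have hq := primePow_pos p e
  refine ⟨Finsupp.equivFunOnFinite.symm fun i => n i / p ^ e,
    Finsupp.equivFunOnFinite.symm fun i => n i % p ^ e, fun i => Nat.div_le_self _ _, fun i => ?_, ?_⟩
  · have := Nat.mod_lt (n i) hq
    simp only [Finsupp.equivFunOnFinite_symm_apply_apply, topExp_apply]
    omega
  · ext i
    simp [Nat.div_add_mod]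

theorem smul_add_inj {e : ℕ} {k k' r r' : Fin 3 →₀ ℕ} (hr : r ≤ topExp p e)
    (hr' : r' ≤ topExp p e) (h : p ^ e • k + r = p ^ e • k' + r') : k = k' ∧ r = r' := by
  have hq := primePow_pos p e
  have key : ∀ i, k i = k' i ∧ r i = r' i := fun i => by
    have h1 := DFunLike.congr_fun h i
    have h2 := hr i
    have h3 := hr' i
    simp only [Finsupp.add_apply, Finsupp.smul_apply, smul_eq_mul, topExp_apply] at h1 h2 h3
    have h4 : r i = r' i := by
      have := congrArg (· % p ^ e) h1
      simpa [Nat.mul_add_mod, Nat.mod_eq_of_lt (show r i < p ^ e by omega),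
        Nat.mod_eq_of_lt (show r' i < p ^ e by omega)] using this
    refine ⟨Nat.eq_of_mul_eq_mul_left hq (by omega), h4⟩
  exact ⟨Finsupp.ext fun i => (key i).1, Finsupp.ext fun i => (key i).2⟩

theorem coeff_monomial_mul_pow (e : ℕ) (c : K) (w : PS K) {k r s : Fin 3 →₀ ℕ}
    (hr : r ≤ topExp p e) (hs : s ≤ topExp p e) :
    MvPowerSeries.coeff (p ^ e • k + r) (MvPowerSeries.monomial s c * w ^ p ^ e) =
      if s = r then c * MvPowerSeries.coeff k w ^ p ^ e else 0 := by
  classical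
  rw [MvPowerSeries.coeff_monomial_mul]
  split_ifs with h1 h2 h2
  · subst h2
    rw [add_tsub_cancel_right, coeff_pow_smul]
  · by_cases hdvd : ∀ i, p ^ e ∣ (p ^ e • k + r - s) i
    · choose g hg using hdvd
      refine absurd (smul_add_inj p (k := Finsupp.equivFunOnFinite.symm g) (k' := k) hs hr ?_).2 h2
      rw [← tsub_add_cancel_of_le h1]
      congr 1
      ext i
      rw [hg i]
      simp
    · push Not at hdvd
      obtain ⟨i, hi⟩ := hdvd
      rw [coeff_pow_of_not_dvd p e w hi, mul_zero]
  · exact absurd (h2 ▸ le_add_self) h1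
  · rfl

/-- Position `topExp p e - r` lies `p ^ e • k + r` below the exponent of the image monomial. By
division with remainder, positions in the box below `topExp p e` therefore reveal every coefficient
of `b` as `k` varies. -/
theorem smul_stdFrob_pow_single_apply (e : ℕ) (b : PS K) (k : Fin 3 →₀ ℕ) (c : K)
    {r : Fin 3 →₀ ℕ} (hr : r ≤ topExp p e) :
    (b • (stdFrob K p ^ e) (Finsupp.single k c)) (topExp p e - r) =
      MvPowerSeries.coeff (p ^ e • k + r) b * c ^ p ^ e := by
  have h1 : topExp p e - r ≤ p ^ e • k + topExp p e := tsub_le_self.trans le_add_self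
  rw [stdFrob_pow_single, smul_single_apply, if_pos h1]
  congr 2
  rw [add_tsub_assoc_of_le tsub_le_self, tsub_tsub_cancel_of_le hr]

/-- On a finite box of exponents, a projection onto the truncation of `I` gives both explicit
elements of `E_S` and elements `w j` of `I`. Testing `b` on the former expresses its truncation
through the powers `w j ^ p ^ e`. -/
theorem mem_frobPower_of_smul_stdFrob_pow_eq_zero {I : Ideal (PS K)} {e : ℕ} {b : PS K}
    (hb : ∀ m ∈ hull I, b • (stdFrob K p ^ e) m = 0) : b ∈ frobPower p I e := by
  classical
  refine mem_ideal_of_forall_coeff fun d => ?_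
  let T : PS K →ₗ[K] (Finset.Iic d → K) :=
    LinearMap.pi fun k => MvPowerSeries.coeff (k : Fin 3 →₀ ℕ)
  have hT : ∀ r k, T r k = MvPowerSeries.coeff (k : Fin 3 →₀ ℕ) r := fun r k => rfl
  obtain ⟨P, hP⟩ := exists_projection ((I.restrictScalars K).map T)
  let δ : Finset.Iic d → Finset.Iic d → K := fun j k => if j = k then 1 else 0
  have hw : ∀ j, ∃ w ∈ I, T w = P (δ j) := fun j => (P (δ j)).2
  choose w hwI hwP using hw
  have hPw : ∀ u ∈ I, ∀ k : Finset.Iic d, ∑ j, T u j * MvPowerSeries.coeff (k : Fin 3 →₀ ℕ) (w j) =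
      T u k := by
    intro u hu k
    have h1 := hP ⟨T u, ⟨u, hu, rfl⟩⟩
    have h2 := LinearMap.pi_apply_eq_sum_univ P (T u)
    have h3 := h2.symm.trans h1
    have h4 := congrFun (congrArg Subtype.val h3) k
    simp only [Submodule.coe_sum, Submodule.coe_smul, Finset.sum_apply, Pi.smul_apply,
      smul_eq_mul] at h4
    rw [← h4]
    refine Finset.sum_congr rfl fun j _ => ?_
    rw [← hT, hwP]
  -- `M k` is the functional `u ↦ (T u - P (T u)) k`, which vanishes on `I`.
  let M : Finset.Iic d → InvPoly K := fun k =>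
    ∑ j : Finset.Iic d, Finsupp.single (j : Fin 3 →₀ ℕ) (δ j k - MvPowerSeries.coeff (k : Fin 3 →₀ ℕ) (w j))
  have hM : ∀ k, M k ∈ hull I := by
    intro k
    refine mem_hull.2 fun u hu => ?_
    ext n
    rw [smul_apply_eq_monomial_mul_smul_apply_zero, Finset.smul_sum, Finsupp.finsetSum_apply]
    have h1 := hPw (MvPowerSeries.monomial n 1 * u) (I.mul_mem_left _ hu) k
    simp only [smul_single_apply, zero_le, if_true, tsub_zero, mul_sub, Finset.sum_sub_distrib]
    simp only [hT] at h1
    rw [h1]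
    simp [δ]
  have hbc : ∀ (k : Finset.Iic d) (r : Fin 3 →₀ ℕ), r ≤ topExp p e →
      MvPowerSeries.coeff (p ^ e • (k : Fin 3 →₀ ℕ) + r) b =
        ∑ j : Finset.Iic d, MvPowerSeries.coeff (p ^ e • (j : Fin 3 →₀ ℕ) + r) b *
          MvPowerSeries.coeff (k : Fin 3 →₀ ℕ) (w j) ^ p ^ e := by
    intro k r hr
    have h1 := DFunLike.congr_fun (hb _ (hM k)) (topExp p e - r)
    rw [map_sum, Finset.smul_sum, Finsupp.finsetSum_apply] at h1
    simp only [smul_stdFrob_pow_single_apply p e b _ _ hr, sub_pow_char_pow, mul_sub,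
      Finset.sum_sub_distrib, Finsupp.zero_apply] at h1
    rw [sub_eq_zero] at h1
    rw [← h1, Finset.sum_eq_single k]
    · simp [δ]
    · intro j _ hj
      rw [show δ j k = 0 from if_neg hj, zero_pow (primePow_pos p e).ne', mul_zero]
    · simp
  -- By `hbc`, this element of `I^[p^e]` has the coefficients of `b` on the box.
  refine ⟨∑ j : Finset.Iic d, ∑ s ∈ Finset.Iic (topExp p e),
    MvPowerSeries.monomial s (MvPowerSeries.coeff (p ^ e • (j : Fin 3 →₀ ℕ) + s) b) *
      w j ^ p ^ e, ?_, ?_⟩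
  · refine sum_mem fun j _ => sum_mem fun s _ => Ideal.mul_mem_left _ _ ?_
    exact Ideal.subset_span ⟨w j, hwI j, rfl⟩
  · intro n hn
    obtain ⟨k, r, hk, hr, rfl⟩ := exists_eq_smul_add p e n
    rw [map_sub, sub_eq_zero, map_sum, hbc ⟨k, Finset.mem_Iic.2 (hk.trans hn)⟩ r hr]
    refine Finset.sum_congr rfl fun j _ => ?_
    rw [map_sum, Finset.sum_eq_single r]
    · rw [coeff_monomial_mul_pow p e _ _ hr hr, if_pos rfl]
    · intro s hs hne
      rw [coeff_monomial_mul_pow p e _ _ hr (Finset.mem_Iic.1 hs), if_neg hne]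
    · intro h
      exact absurd (Finset.mem_Iic.2 hr) h

/-- For `u ∈ I`, `a * u` lies in `I^[p^e]`, whose generators `v ^ p ^ e` kill `f^e(m)` because `v`
kills `m`. -/
theorem smul_stdFrob_pow_mem_hull {I : Ideal (PS K)} {e : ℕ} {a : PS K}
    (ha : a ∈ colonIdeal p I e) {m : InvPoly K} (hm : m ∈ hull I) :
    a • (stdFrob K p ^ e) m ∈ hull I := by
  refine mem_hull.2 fun u hu => ?_
  rw [← mul_smul, mul_comm]
  have h1 : a * u ∈ frobPower p I e := Submodule.mem_colon.1 ha u hu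
  refine Submodule.mem_annihilator_span_singleton _ _ |>.1 (?_ : a * u ∈ _)
  refine (Ideal.span_le (I := (Submodule.span (PS K)
    {(stdFrob K p ^ e) m}).annihilator)).2 ?_ h1
  rintro _ ⟨v, hv, rfl⟩
  refine (Submodule.mem_annihilator_span_singleton _ _).2 ?_
  rw [← stdFrob_pow_smul, mem_hull.1 hm v hv, map_zero]

theorem exists_eq_smul_stdFrob_pow {I : Ideal (PS K)} {e : ℕ} {φ : AddMonoid.End (hull I)}
    (hφ : φ ∈ frobMaps (PS K ⧸ I) p (hull I) e) :
    ∃ a ∈ colonIdeal p I e, ∀ m : hull I, (φ m : InvPoly K) = a • (stdFrob K p ^ e) (m : InvPoly K) := by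
  classical
  suffices h : ∃ a : PS K, ∀ m : hull I,
      (φ m : InvPoly K) = a • (stdFrob K p ^ e) (m : InvPoly K) by
    obtain ⟨a, ha⟩ := h
    refine ⟨a, Submodule.mem_colon.2 fun u hu => ?_, ha⟩
    refine mem_frobPower_of_smul_stdFrob_pow_eq_zero p fun m hm => ?_
    rw [smul_eq_mul, mul_comm, mul_smul, ← ha ⟨m, hm⟩]
    exact mem_hull.1 (φ ⟨m, hm⟩).2 u hu
  -- A `K`-linear retraction onto `E_S` makes `φ` applicable to single monomials, at the price of
  -- semilinearity over `K` only.
  obtain ⟨Q, hQ_add, hQ_smul, hQ⟩ : ∃ Q : InvPoly K → hull I, (∀ m m', Q (m + m') = Q m + Q m') ∧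
      (∀ (c : K) m, Q (c • m) = (MvPowerSeries.C c : PS K) • Q m) ∧ ∀ m : hull I, Q m = m := by
    obtain ⟨P, hP⟩ := exists_projection ((hull I).restrictScalars K)
    exact ⟨fun m => P m, fun m m' => map_add P m m',
      fun c m => (map_smul P c m).trans (Subtype.ext (C_smul c _).symm), hP⟩
  let ψ : InvPoly K → InvPoly K := fun m => φ (Q m)
  have hψ_add : ∀ m m', ψ (m + m') = ψ m + ψ m' := fun m m' => by
    simp only [ψ, hQ_add, map_add, Submodule.coe_add]
  have hψ_smul : ∀ (c : K) m, ψ (c • m) = c ^ p ^ e • ψ m := fun c m => by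
    simp only [ψ]
    rw [hQ_smul, frobMaps_apply_smul hφ, ← map_pow, Submodule.coe_smul, C_smul]
  have hψ : ∀ m : hull I, ψ m = φ m := fun m => by simp only [ψ, hQ]
  let q : (Fin 3 →₀ ℕ) → (Fin 3 →₀ ℕ) := fun n => (exists_eq_smul_add p e n).choose
  let r : (Fin 3 →₀ ℕ) → (Fin 3 →₀ ℕ) := fun n => (exists_eq_smul_add p e n).choose_spec.choose
  have hqr : ∀ n, q n ≤ n ∧ r n ≤ topExp p e ∧ n = p ^ e • q n + r n := fun n =>
    (exists_eq_smul_add p e n).choose_spec.choose_spec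
  -- The only choice compatible with `smul_stdFrob_pow_single_apply`.
  let a : PS K := fun n => ψ (Finsupp.single (q n) 1) (topExp p e - r n)
  have ha : ∀ k s, s ≤ topExp p e → MvPowerSeries.coeff (p ^ e • k + s) a =
      ψ (Finsupp.single k 1) (topExp p e - s) := by
    intro k s hs
    obtain ⟨-, h2, h3⟩ := hqr (p ^ e • k + s)
    obtain ⟨h4, h5⟩ := smul_add_inj p h2 hs h3.symm
    change ψ (Finsupp.single (q (p ^ e • k + s)) 1) (topExp p e - r (p ^ e • k + s)) = _
    rw [h4, h5]
  have key : ∀ (m : InvPoly K) (s : Fin 3 →₀ ℕ), s ≤ topExp p e →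
      ψ m (topExp p e - s) = (a • (stdFrob K p ^ e) m) (topExp p e - s) := by
    intro m s hs
    induction m using Finsupp.induction_linear with
    | zero =>
      have : ψ 0 = 0 := by simpa using hψ_add 0 0
      simp [this]
    | add f g hf hg => rw [hψ_add, map_add, smul_add, Finsupp.add_apply, hf, hg, Finsupp.add_apply]
    | single k c =>
      rw [smul_stdFrob_pow_single_apply p e a k c hs, ha k s hs]
      have : (Finsupp.single k c : InvPoly K) = c • Finsupp.single k 1 := by simp
      rw [this, hψ_smul, Finsupp.smul_apply, smul_eq_mul, mul_comm]
  refine ⟨a, fun m => ?_⟩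
  ext n
  obtain ⟨k, s, -, hs, rfl⟩ := exists_eq_smul_add p e n
  have hmon : (MvPowerSeries.monomial (p ^ e • k) (1 : K) : PS K) =
      MvPowerSeries.monomial k 1 ^ p ^ e := by
    rw [MvPowerSeries.monomial_pow, one_pow]
  -- `key` covers only exponents in the box; on `E_S`, multiplying `m` by the monomial of exponent
  -- `k` shifts the exponent `p ^ e • k + s` into it.
  have h1 := key ((MvPowerSeries.monomial k (1 : K) • m : hull I) : InvPoly K) (topExp p e - s)
    tsub_le_self
  rw [tsub_tsub_cancel_of_le hs, hψ, frobMaps_apply_smul hφ] at h1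
  rw [Submodule.coe_smul, Submodule.coe_smul, stdFrob_pow_smul, smul_smul, mul_comm a, mul_smul,
    ← hmon, monomial_smul_apply, monomial_smul_apply] at h1
  exact h1

end Representation

/-! ### Frobenius powers and products of colon ideals -/

section FrobeniusPowers

/-- The product `K_{β₁} K_{β₂}^[p^β₁] K_{β₃}^[p^(β₁ + β₂)] ⋯` of a list of exponents. -/
def colonProd {R : Type u} [CommRing R] (p : ℕ) (I : Ideal R) : List ℕ → Ideal R
  | [] => 1
  | β :: l => colonIdeal p I β * frobPower p (colonProd p I l) β

/-- The sum of the products of colon ideals over all compositions of `d` into parts `< e`. -/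
def lIdealLT {R : Type u} [CommRing R] (p : ℕ) (I : Ideal R) (e d : ℕ) : Ideal R :=
  ⨆ (l : List ℕ) (_ : (∀ β ∈ l, 1 ≤ β ∧ β < e) ∧ l.sum = d), colonProd p I l

theorem colonProd_le_lIdealLT {R : Type u} [CommRing R] (p : ℕ) (I : Ideal R) {e : ℕ} {l : List ℕ}
    (hl : ∀ β ∈ l, 1 ≤ β ∧ β < e) : colonProd p I l ≤ lIdealLT p I e l.sum :=
  le_iSup₂_of_le (f := fun (l' : List ℕ) (_ : (∀ β ∈ l', 1 ≤ β ∧ β < e) ∧ l'.sum = l.sum) =>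
    colonProd p I l') l ⟨hl, rfl⟩ le_rfl

theorem lIdealLT_zero {R : Type u} [CommRing R] (p : ℕ) (I : Ideal R) (e : ℕ) :
    lIdealLT p I e 0 = ⊤ :=
  top_le_iff.1 ((Ideal.one_eq_top (R := R)).symm.le.trans
    (colonProd_le_lIdealLT p I (e := e) (l := []) (by simp)))

variable {R : Type u} [CommRing R] (p : ℕ) [ExpChar R p]

theorem frobPower_eq_map (I : Ideal R) (e : ℕ) :
    frobPower p I e = I.map (iterateFrobenius R p e) := by
  rw [frobPower, Ideal.map]
  congr 1
  ext x
  simp [iterateFrobenius_def, eq_comm]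

theorem frobPower_zero (I : Ideal R) : frobPower p I 0 = I := by
  rw [frobPower_eq_map, iterateFrobenius_zero, Ideal.map_id]

theorem frobPower_add (I : Ideal R) (d e : ℕ) :
    frobPower p I (d + e) = frobPower p (frobPower p I e) d := by
  simp only [frobPower_eq_map, Ideal.map_map, iterateFrobenius_add]

theorem frobPower_one (e : ℕ) : frobPower p (1 : Ideal R) e = 1 := by
  rw [frobPower_eq_map, Ideal.one_eq_top, Ideal.map_top]

theorem frobPower_mul (I J : Ideal R) (e : ℕ) :
    frobPower p (I * J) e = frobPower p I e * frobPower p J e := by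
  simp only [frobPower_eq_map, Ideal.map_mul]

theorem frobPower_prod {ι : Type*} (s : Finset ι) (J : ι → Ideal R) (e : ℕ) :
    frobPower p (∏ i ∈ s, J i) e = ∏ i ∈ s, frobPower p (J i) e := by
  simp only [frobPower_eq_map]
  exact map_prod (Ideal.mapHom (iterateFrobenius R p e)) J s

theorem frobPower_iSup {ι : Sort*} (J : ι → Ideal R) (e : ℕ) :
    frobPower p (⨆ i, J i) e = ⨆ i, frobPower p (J i) e := by
  simp only [frobPower_eq_map, Ideal.map_iSup]

theorem colonProd_append (I : Ideal R) (l l' : List ℕ) :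
    colonProd p I (l ++ l') = colonProd p I l * frobPower p (colonProd p I l') l.sum := by
  induction l with
  | nil => simp [colonProd, frobPower_zero]
  | cons β l ih =>
    rw [List.cons_append, colonProd, ih, colonProd, frobPower_mul, List.sum_cons, frobPower_add,
      mul_assoc]

theorem prod_frobPower_colonIdeal (I : Ideal R) (l : List ℕ) :
    ∏ i : Fin l.length, frobPower p (colonIdeal p I (l.get i)) (l.take i).sum =
      colonProd p I l := by
  induction l with
  | nil => simp [colonProd]
  | cons β l ih =>
    rw [colonProd, ← ih, frobPower_prod]
    refine (Fin.prod_univ_succ (n := l.length) _).trans ?_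
    congr 1
    · simp [frobPower_zero]
    · refine Finset.prod_congr rfl fun i _ => ?_
      simp [frobPower_add]

theorem lIdeal_eq_lIdealLT (I : Ideal R) (e : ℕ) : lIdeal p I e = lIdealLT p I e e := by
  refine le_antisymm (iSup₂_le fun c hc => ?_) (iSup₂_le fun l hl => ?_)
  · refine le_trans (le_of_eq (prod_frobPower_colonIdeal p I c.blocks))
      (le_iSup₂_of_le c.blocks ⟨fun β hβ => ⟨c.blocks_pos hβ, ?_⟩, c.blocks_sum⟩ le_rfl)
    obtain ⟨i, rfl⟩ := List.get_of_mem hβ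
    exact hc i
  · refine le_trans (le_of_eq (prod_frobPower_colonIdeal p I l).symm) ?_
    exact le_iSup₂_of_le
      (⟨l, fun {i} hi => (hl.1 i hi).1, hl.2⟩ : Composition e)
      (fun i => (hl.1 _ (List.get_mem l i)).2) le_rfl

theorem colonIdeal_le_lIdealLT (I : Ideal R) {e d : ℕ} (hd : d < e) :
    colonIdeal p I d ≤ lIdealLT p I e d := by
  rcases Nat.eq_zero_or_pos d with rfl | h
  · rw [lIdealLT_zero]
    exact le_top
  · have := colonProd_le_lIdealLT p I (e := e) (l := [d]) (by simp; omega)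
    simpa only [colonProd, frobPower_one, mul_one, List.sum_singleton] using this

theorem lIdealLT_mul_frobPower_le (I : Ideal R) (e d d' : ℕ) :
    lIdealLT p I e d * frobPower p (lIdealLT p I e d') d ≤ lIdealLT p I e (d + d') := by
  simp only [lIdealLT, frobPower_iSup, Ideal.iSup_mul, Ideal.mul_iSup]
  refine iSup₂_le fun l hl => iSup₂_le fun l' hl' => ?_
  -- `l` indexes the twisted right factor, so it comes last in the concatenation.
  refine le_trans (le_of_eq ?_) (le_iSup₂_of_le (l' ++ l)
    ⟨fun β hβ => (List.mem_append.1 hβ).elim (hl'.1 β) (hl.1 β), ?_⟩ le_rfl)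
  · rw [colonProd_append, hl'.2]
  · rw [List.sum_append, hl.2, hl'.2]

end FrobeniusPowers

/-! ### Coefficients of the generated subalgebra -/

section Degrees

variable {K : Type u} [Field K] (p : ℕ) [Fact p.Prime] [CharP K p]

instance expChar_PS : ExpChar (PS K) p :=
  have : CharP (PS K) p := charP_of_injective_algebraMap (algebraMap K (PS K)).injective p
  .prime Fact.out

theorem smul_stdFrob_pow_comp (i j : ℕ) (a b : PS K) (m : InvPoly K) :
    a • (stdFrob K p ^ i) (b • (stdFrob K p ^ j) m) =
      (a * b ^ p ^ i) • (stdFrob K p ^ (i + j)) m := by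
  rw [stdFrob_pow_smul, stdFrob_pow_add, mul_smul]

/-- All degrees are treated at once, since a component of a product involves all components of the
factors. -/
theorem exists_mem_lIdealLT_of_mem_frobAlgLT {I : Ideal (PS K)} {e : ℕ}
    {x : FrobAlg (PS K ⧸ I) p (hull I)} (hx : x ∈ frobAlgLT (PS K ⧸ I) p (hull I) e) :
    ∀ d, ∃ a ∈ lIdealLT p I e d, ∀ m : hull I,
      (((x d : frobMaps (PS K ⧸ I) p (hull I) d) : AddMonoid.End (hull I)) m : InvPoly K) =
        a • (stdFrob K p ^ d) (m : InvPoly K) := by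
  induction hx using Subring.closure_induction with
  | mem x hx =>
    obtain ⟨i, φ, hi, rfl⟩ := hx
    intro d
    by_cases hd : i = d
    · subst hd
      rw [DirectSum.of_eq_same]
      obtain ⟨a, ha, h⟩ := exists_eq_smul_stdFrob_pow p φ.2
      exact ⟨a, colonIdeal_le_lIdealLT p I hi ha, h⟩
    · rw [DirectSum.of_eq_of_ne _ _ _ (Ne.symm hd)]
      exact ⟨0, zero_mem _, fun m => by rw [zero_smul]; rfl⟩
  | zero => exact fun d => ⟨0, zero_mem _, fun m => by rw [zero_smul]; rfl⟩
  | one =>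
    intro d
    by_cases hd : d = 0
    · subst hd
      refine ⟨1, by rw [lIdealLT_zero]; trivial, fun m => ?_⟩
      rw [DirectSum.one_def, DirectSum.of_eq_same, one_smul]
      rfl
    · rw [DirectSum.one_def, DirectSum.of_eq_of_ne _ _ _ hd]
      exact ⟨0, zero_mem _, fun m => by rw [zero_smul]; rfl⟩
  | add x y _ _ hx hy =>
    intro d
    obtain ⟨a, ha, h⟩ := hx d
    obtain ⟨b, hb, h'⟩ := hy d
    refine ⟨a + b, add_mem ha hb, fun m => ?_⟩
    rw [add_smul, ← h, ← h']
    rfl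
  | neg x _ hx =>
    intro d
    obtain ⟨a, ha, h⟩ := hx d
    refine ⟨-a, neg_mem ha, fun m => ?_⟩
    rw [neg_smul, ← h]
    rfl
  | mul x y _ _ hx hy =>
    intro d
    choose a ha h using hx
    choose b hb h' using hy
    refine ⟨∑ ij ∈ Finset.HasAntidiagonal.antidiagonal d, a ij.1 * b ij.2 ^ p ^ ij.1, sum_mem ?_, fun m => ?_⟩
    · rintro ⟨i, j⟩ hij
      rw [← Finset.HasAntidiagonal.mem_antidiagonal.1 hij]
      exact lIdealLT_mul_frobPower_le p I e i j
        (Ideal.mul_mem_mul (ha i) (Ideal.subset_span ⟨b j, hb j, rfl⟩))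
    · have h1 : (((x * y) d : frobMaps (PS K ⧸ I) p (hull I) d) : AddMonoid.End (hull I)) =
          ∑ ij ∈ Finset.HasAntidiagonal.antidiagonal d, (x ij.1 : AddMonoid.End (hull I)) * y ij.2 :=
        DirectSum.coe_mul_apply_eq_sum_antidiagonal _ x y d
      have h2 : (((x * y) d : frobMaps (PS K ⧸ I) p (hull I) d) : AddMonoid.End (hull I)) m =
          ∑ ij ∈ Finset.HasAntidiagonal.antidiagonal d,
            (x ij.1 : AddMonoid.End (hull I)) ((y ij.2 : AddMonoid.End (hull I)) m) := by
        rw [h1]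
        exact AddMonoidHom.finsetSum_apply _ _ m
      rw [h2, Submodule.coe_sum, Finset.sum_smul]
      refine Finset.sum_congr rfl ?_
      rintro ⟨i, j⟩ hij
      rw [h, h', smul_stdFrob_pow_comp, Finset.HasAntidiagonal.mem_antidiagonal.1 hij]

/-- `a f ^ d` is a map that belongs to the subalgebra generated in degrees `< e`. -/
def IsGenCoeff (I : Ideal (PS K)) (e d : ℕ) (a : PS K) : Prop :=
  ∃ φ : frobMaps (PS K ⧸ I) p (hull I) d,
    DirectSum.of (fun j => frobMaps (PS K ⧸ I) p (hull I) j) d φ ∈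
      frobAlgLT (PS K ⧸ I) p (hull I) e ∧
    ∀ m : hull I, ((φ : AddMonoid.End (hull I)) m : InvPoly K) =
      a • (stdFrob K p ^ d) (m : InvPoly K)

variable {p}

theorem IsGenCoeff.zero {I : Ideal (PS K)} {e d : ℕ} : IsGenCoeff p I e d 0 :=
  ⟨0, by rw [map_zero]; exact zero_mem _, fun m => by rw [zero_smul]; rfl⟩

theorem IsGenCoeff.add {I : Ideal (PS K)} {e d : ℕ} {a b : PS K} (ha : IsGenCoeff p I e d a)
    (hb : IsGenCoeff p I e d b) : IsGenCoeff p I e d (a + b) := by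
  obtain ⟨φ, hφ, h⟩ := ha
  obtain ⟨φ', hφ', h'⟩ := hb
  refine ⟨φ + φ', by rw [map_add]; exact add_mem hφ hφ', fun m => ?_⟩
  rw [add_smul, ← h, ← h']
  rfl

theorem IsGenCoeff.mul_pow {I : Ideal (PS K)} {e d d' : ℕ} {a b : PS K}
    (ha : IsGenCoeff p I e d a) (hb : IsGenCoeff p I e d' b) :
    IsGenCoeff p I e (d + d') (a * b ^ p ^ d) := by
  obtain ⟨φ, hφ, h⟩ := ha
  obtain ⟨φ', hφ', h'⟩ := hb
  refine ⟨⟨φ * φ', SetLike.mul_mem_graded φ.2 φ'.2⟩, ?_, fun m => ?_⟩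
  · have := mul_mem hφ hφ'
    rwa [DirectSum.of_mul_of] at this
  · rw [← smul_stdFrob_pow_comp, ← h', ← h]
    rfl

theorem isGenCoeff_of_mem_colonIdeal {I : Ideal (PS K)} {e d : ℕ} (hd : d < e) {a : PS K}
    (ha : a ∈ colonIdeal p I d) : IsGenCoeff p I e d a := by
  let φ : AddMonoid.End (hull I) :=
    { toFun := fun m => ⟨a • (stdFrob K p ^ d) (m : InvPoly K),
        smul_stdFrob_pow_mem_hull p ha m.2⟩
      map_zero' := Subtype.ext (by
        change a • (stdFrob K p ^ d) (0 : InvPoly K) = 0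
        rw [map_zero, smul_zero])
      map_add' := fun m m' => Subtype.ext (by
        change a • (stdFrob K p ^ d) ((m : InvPoly K) + m') =
          a • (stdFrob K p ^ d) (m : InvPoly K) + a • (stdFrob K p ^ d) (m' : InvPoly K)
        rw [map_add, smul_add]) }
  have hφ : φ ∈ frobMaps (PS K ⧸ I) p (hull I) d := by
    intro s m
    obtain ⟨r, rfl⟩ := Ideal.Quotient.mk_surjective s
    rw [← map_pow, Submodule.torsionBySet.mk_smul, Submodule.torsionBySet.mk_smul]
    refine Subtype.ext ?_
    change a • (stdFrob K p ^ d) (r • (m : InvPoly K)) =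
      r ^ p ^ d • a • (stdFrob K p ^ d) (m : InvPoly K)
    rw [stdFrob_pow_smul, smul_comm]
  exact ⟨⟨φ, hφ⟩, Subring.subset_closure ⟨d, ⟨φ, hφ⟩, hd, rfl⟩, fun m => rfl⟩

theorem isGenCoeff_zero_right {I : Ideal (PS K)} {e : ℕ} (he : 1 ≤ e) (a : PS K) :
    IsGenCoeff p I e 0 a := by
  refine isGenCoeff_of_mem_colonIdeal he (Submodule.mem_colon.2 fun u hu => ?_)
  rw [frobPower_zero]
  exact I.mul_mem_left a hu

/-- The ideal of the `a` for which `a f ^ d` belongs to the subalgebra generated in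
degrees `< e`. -/
def genCoeffIdeal (I : Ideal (PS K)) {e : ℕ} (he : 1 ≤ e) (d : ℕ) : Ideal (PS K) where
  carrier := {a | IsGenCoeff p I e d a}
  zero_mem' := .zero
  add_mem' := .add
  smul_mem' r a ha := by
    have := (isGenCoeff_zero_right he r).mul_pow ha
    rwa [zero_add, pow_zero, pow_one] at this

theorem colonProd_le_genCoeffIdeal (I : Ideal (PS K)) {e : ℕ} (he : 1 ≤ e) (l : List ℕ)
    (hl : ∀ β ∈ l, 1 ≤ β ∧ β < e) : colonProd p I l ≤ genCoeffIdeal (p := p) I he l.sum := by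
  induction l with
  | nil => exact fun a _ => isGenCoeff_zero_right he a
  | cons β l ih =>
    rw [colonProd, Ideal.mul_le]
    intro a ha b hb
    have ha' := isGenCoeff_of_mem_colonIdeal (hl β (by simp)).2 ha
    have ih' := ih fun γ hγ => hl γ (List.mem_cons_of_mem β hγ)
    rw [List.sum_cons]
    -- Composition handles only the generators `c ^ p ^ β` of the twisted factor; the ideal property
    -- gives their combinations.
    refine Submodule.span_induction (p := fun b _ => a * b ∈ genCoeffIdeal I he (β + l.sum))
      ?_ ?_ ?_ ?_ hb
    · rintro _ ⟨c, hc, rfl⟩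
      exact ha'.mul_pow (ih' hc)
    · rw [mul_zero]
      exact zero_mem _
    · intro x y _ _ hx hy
      rw [mul_add]
      exact add_mem hx hy
    · intro r x _ hx
      rw [smul_eq_mul, mul_left_comm]
      exact Ideal.mul_mem_left _ r hx

theorem isGenCoeff_of_mem_lIdeal {I : Ideal (PS K)} {e : ℕ} (he : 1 ≤ e) {a : PS K}
    (ha : a ∈ lIdeal p I e) : IsGenCoeff p I e e a := by
  rw [lIdeal_eq_lIdealLT] at ha
  have : lIdealLT p I e e ≤ genCoeffIdeal (p := p) I he e := iSup₂_le fun l hl => by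
    have := colonProd_le_genCoeffIdeal (p := p) I he l hl.1
    rwa [hl.2] at this
  exact this ha

end Degrees

end FrobeniusMaps

theorem mainTheorem2 {K : Type u} [Field K] (p : ℕ) [Fact p.Prime] [CharP K p]
    (I : Ideal (FrobeniusMaps.PS K)) :
    -- the built modules `E` and `E_S` are injective hulls of the residue fields of `R` and `S`
    FrobeniusMaps.IsInjectiveHull (FrobeniusMaps.PS K)
      (IsLocalRing.ResidueField (FrobeniusMaps.PS K)) (FrobeniusMaps.InvPoly K) ∧
    (I ≠ ⊤ → ∃ _ : IsLocalRing (FrobeniusMaps.PS K ⧸ I),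
      FrobeniusMaps.IsInjectiveHull (FrobeniusMaps.PS K ⧸ I)
        (IsLocalRing.ResidueField (FrobeniusMaps.PS K ⧸ I)) (FrobeniusMaps.hull I)) ∧
    -- the degree `e` part of the subalgebra generated in degrees `< e` is `L_e f^e`
    ∀ e : ℕ, 1 ≤ e →
      {ψ : FrobeniusMaps.hull I → FrobeniusMaps.InvPoly K |
        ∃ φ : FrobeniusMaps.frobMaps (FrobeniusMaps.PS K ⧸ I) p (FrobeniusMaps.hull I) e,
          DirectSum.of
              (fun j => FrobeniusMaps.frobMaps (FrobeniusMaps.PS K ⧸ I) p (FrobeniusMaps.hull I) j)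
              e φ ∈
            FrobeniusMaps.frobAlgLT (FrobeniusMaps.PS K ⧸ I) p (FrobeniusMaps.hull I) e ∧
          ψ = fun m => ((φ : AddMonoid.End (FrobeniusMaps.hull I)) m : FrobeniusMaps.InvPoly K)} =
      {ψ : FrobeniusMaps.hull I → FrobeniusMaps.InvPoly K |
        ∃ a ∈ FrobeniusMaps.lIdeal p I e,
          ψ = fun m : FrobeniusMaps.hull I =>
            a • (FrobeniusMaps.stdFrob K p ^ e) (m : FrobeniusMaps.InvPoly K)} := by
  refine ⟨FrobeniusMaps.invPoly_isInjectiveHull, fun hI => ?_, fun e he => ?_⟩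
  · have := FrobeniusMaps.isLocalRing_quotient hI
    exact ⟨this, FrobeniusMaps.hull_isInjectiveHull I hI⟩
  · ext ψ
    constructor
    · rintro ⟨φ, hφ, rfl⟩
      obtain ⟨a, ha, h⟩ := FrobeniusMaps.exists_mem_lIdealLT_of_mem_frobAlgLT p hφ e
      rw [DirectSum.of_eq_same] at h
      exact ⟨a, by rwa [FrobeniusMaps.lIdeal_eq_lIdealLT], funext h⟩
    · rintro ⟨a, ha, rfl⟩
      obtain ⟨φ, hφ, h⟩ := FrobeniusMaps.isGenCoeff_of_mem_lIdeal he ha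
      exact ⟨φ, hφ, (funext h).symm⟩
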